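/- Let $\mathcal{G}$ be a locally compact Hausdorff étale groupoid (a topological groupoid whose range and source maps $r,s:\mathcal{G}\to X$ are local homeomorphisms) with $\sigma$-compact unit space $X$. Let $C_0^s(\mathcal{G})$ be the commutative $C^*$-algebra of bounded continuous functions $f:\mathcal{G}\to\mathbb{C}$ such that for every $\varepsilon>0$ there is a compact set $K\subset X$ with $|f(\gamma)|<\varepsilon$ whenever $s(\gamma)\notin K$, and let $\beta_X\mathcal{G}$ be its spectrum (the space of nonzero characters with the weak-$*$ topology). The anchor map $\tilde s:\beta_X\mathcal{G}\to X$ is determined by $\chi(e\circ s)=e(\tilde s(\chi))$ for all $e\in C_0(X)$. The groupoid $\mathcal{G}$ acts continuously on the right on $\beta_X\mathcal{G}$ as follows: if $\tilde s(\chi)=r(\gamma)$, then $\chi\cdot\gamma$ is the unique character, with $\tilde s(\chi\cdot\gamma)=s(\gamma)$, such that $(\chi\cdot\gamma)(f)=\chi(g)$ whenever $f,g\in C_0^s(\mathcal{G})$ satisfy $g(\eta)=f(\eta\delta)$ for all $\delta$ in some neighbourhood of $\gamma$ and all $\eta$ with $s(\eta)=r(\delta)$; for every $f$ such a $g$ exists.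 Let $Z$ be a locally compact Hausdorff right $\mathcal{G}$-space, that is, $Z$ has a continuous anchor map $\pi:Z\to X$ and a continuous right action $(z,\gamma)\mapsto z\cdot\gamma$, defined for $\pi(z)=r(\gamma)$, with $\pi(z\cdot\gamma)=s(\gamma)$, $z\cdot\pi(z)=z$ and $(z\cdot\gamma)\cdot\gamma'=z\cdot(\gamma\gamma')$. Suppose that $\pi$ is proper and surjective and admits a continuous (not necessarily equivariant) section $\sigma:X\to Z$. Then there is a continuous proper $\mathcal{G}$-equivariant map $\tilde\theta:\beta_X\mathcal{G}\to Z$; equivariance means that $\pi\circ\tilde\theta=\tilde s$ and $\tilde\theta(\chi\cdot\gamma)=\tilde\theta(\chi)\cdot\gamma$ whenever $\tilde s(\chi)=r(\gamma)$. -/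

import Mathlib

open Topology Filter Set
open scoped BoundedContinuousFunction ZeroAtInfty

/-- A topological groupoid with space of arrows `G` and space of units `X`: the source `s`, the
range `r`, the product (defined on the composable pairs `(γ, η)`, those with `s γ = r η`), the unit
map and the inverse are continuous and satisfy the groupoid identities. -/
structure TopologicalGroupoid (G X : Type*) [TopologicalSpace G] [TopologicalSpace X] where
  s : G → X
  r : G → X
  mul : {p : G × G // s p.1 = r p.2} → G
  unit : X → G
  inv : G → G
  r_mul : ∀ p, r (mul p) = r p.1.1
  s_mul : ∀ p, s (mul p) = s p.1.2
  mul_assoc : ∀ (γ η δ : G) (h₁ : s γ = r η) (h₂ : s η = r δ),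
    mul ⟨(γ, mul ⟨(η, δ), h₂⟩), h₁.trans (r_mul ⟨(η, δ), h₂⟩).symm⟩ =
      mul ⟨(mul ⟨(γ, η), h₁⟩, δ), (s_mul ⟨(γ, η), h₁⟩).trans h₂⟩
  s_unit : ∀ x, s (unit x) = x
  r_unit : ∀ x, r (unit x) = x
  mul_unit : ∀ γ, mul ⟨(γ, unit (s γ)), (r_unit _).symm⟩ = γ
  unit_mul : ∀ γ, mul ⟨(unit (r γ), γ), s_unit _⟩ = γ
  r_inv : ∀ γ, r (inv γ) = s γ
  s_inv : ∀ γ, s (inv γ) = r γ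
  mul_inv : ∀ γ, mul ⟨(γ, inv γ), (r_inv γ).symm⟩ = unit (r γ)
  inv_mul : ∀ γ, mul ⟨(inv γ, γ), s_inv γ⟩ = unit (s γ)
  continuous_s : Continuous s
  continuous_r : Continuous r
  continuous_mul : Continuous mul
  continuous_unit : Continuous unit
  continuous_inv : Continuous inv

namespace TopologicalGroupoid

variable {G X : Type*} [TopologicalSpace G] [TopologicalSpace X]

/-- The groupoid is étale: range and source are local homeomorphisms. -/
structure IsEtale (𝒢 : TopologicalGroupoid G X) : Prop where
  s_localHomeo : IsLocalHomeomorph 𝒢.s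
  r_localHomeo : IsLocalHomeomorph 𝒢.r

/-- A (right) `𝒢`-space: a space `Z` with a continuous anchor map `Z → X` and a continuous
right action `(z, γ) ↦ z · γ`, defined when `anchor z = r γ`. -/
structure RightAction (𝒢 : TopologicalGroupoid G X) (Z : Type*) [TopologicalSpace Z] where
  anchor : Z → X
  act : {p : Z × G // anchor p.1 = 𝒢.r p.2} → Z
  anchor_act : ∀ p, anchor (act p) = 𝒢.s p.1.2
  act_unit : ∀ z, act ⟨(z, 𝒢.unit (anchor z)), (𝒢.r_unit _).symm⟩ = z
  act_act : ∀ (z : Z) (γ η : G) (h₁ : anchor z = 𝒢.r γ) (h₂ : 𝒢.s γ = 𝒢.r η),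
    act ⟨(act ⟨(z, γ), h₁⟩, η), (anchor_act ⟨(z, γ), h₁⟩).trans h₂⟩ =
      act ⟨(z, 𝒢.mul ⟨(γ, η), h₂⟩), h₁.trans (𝒢.r_mul ⟨(γ, η), h₂⟩).symm⟩
  continuous_anchor : Continuous anchor
  continuous_act : Continuous act

/-- A map `θ : Y → Z` of `𝒢`-spaces is equivariant: it commutes with the anchor maps, and
`θ (y · γ) = θ y · γ` whenever `y · γ` is defined. -/
def IsEquivariant {𝒢 : TopologicalGroupoid G X} {Y Z : Type*} [TopologicalSpace Y]
    [TopologicalSpace Z] (A : 𝒢.RightAction Y) (B : 𝒢.RightAction Z) (θ : Y → Z) : Prop :=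
  ∃ hθ : ∀ y, B.anchor (θ y) = A.anchor y,
    ∀ (y : Y) (γ : G) (h : A.anchor y = 𝒢.r γ),
      θ (A.act ⟨(y, γ), h⟩) = B.act ⟨(θ y, γ), (hθ y).trans h⟩

/-- The algebra `C₀ˢ(𝒢)` of the bounded continuous functions `f : G → ℂ` such that for
every `ε > 0` there is a compact `K ⊆ X` with `|f γ| < ε` whenever `s γ ∉ K`. -/
def C0s (𝒢 : TopologicalGroupoid G X) : NonUnitalStarSubalgebra ℂ (G →ᵇ ℂ) where
  carrier := {f | ∀ ε : ℝ, 0 < ε → ∃ K : Set X, IsCompact K ∧ ∀ γ, 𝒢.s γ ∉ K → ‖f γ‖ < ε}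
  add_mem' := by
    intro f g hf hg ε hε
    obtain ⟨K, hK, hfK⟩ := hf (ε / 2) (half_pos hε)
    obtain ⟨L, hL, hgL⟩ := hg (ε / 2) (half_pos hε)
    refine ⟨K ∪ L, hK.union hL, fun γ hγ => ?_⟩
    have h1 := hfK γ (fun h => hγ (Or.inl h))
    have h2 := hgL γ (fun h => hγ (Or.inr h))
    calc ‖(f + g) γ‖ ≤ ‖f γ‖ + ‖g γ‖ := norm_add_le _ _
      _ < ε := by linarith
  zero_mem' := fun ε hε => ⟨∅, isCompact_empty, fun γ _ => by simpa using hε⟩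
  mul_mem' := by
    intro f g hf hg ε hε
    have hg' : 0 < ‖g‖ + 1 := by positivity
    obtain ⟨K, hK, hfK⟩ := hf (ε / (‖g‖ + 1)) (div_pos hε hg')
    refine ⟨K, hK, fun γ hγ => ?_⟩
    have h1 := hfK γ hγ
    have h2 : ‖g γ‖ ≤ ‖g‖ := g.norm_coe_le_norm γ
    rw [lt_div_iff₀ hg'] at h1
    calc ‖(f * g) γ‖ ≤ ‖f γ‖ * ‖g γ‖ := norm_mul_le _ _
      _ ≤ ‖f γ‖ * (‖g‖ + 1) := by gcongr; linarith
      _ < ε := h1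
  smul_mem' := by
    intro c f hf ε hε
    have hc' : 0 < ‖c‖ + 1 := by positivity
    obtain ⟨K, hK, hfK⟩ := hf (ε / (‖c‖ + 1)) (div_pos hε hc')
    refine ⟨K, hK, fun γ hγ => ?_⟩
    have h1 := hfK γ hγ
    rw [lt_div_iff₀ hc'] at h1
    calc ‖(c • f) γ‖ = ‖f γ‖ * ‖c‖ := by simp [mul_comm]
      _ ≤ ‖f γ‖ * (‖c‖ + 1) := by gcongr; linarith
      _ < ε := h1
  star_mem' := by
    intro f hf ε hε
    obtain ⟨K, hK, hfK⟩ := hf ε hε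
    exact ⟨K, hK, fun γ hγ => by simpa using hfK γ hγ⟩

/-- The space `β_X 𝒢`: the spectrum of the commutative C*-algebra `C₀ˢ(𝒢)`, that is, the space of
its nonzero characters with the weak-* topology. -/
abbrev Beta (𝒢 : TopologicalGroupoid G X) : Type _ :=
  WeakDual.characterSpace ℂ 𝒢.C0s

/-- The homomorphism `s^* : C₀(X) → C₀ˢ(𝒢)`, `e ↦ e ∘ s`. -/
noncomputable def sStar (𝒢 : TopologicalGroupoid G X) : C₀(X, ℂ) →⋆ₙₐ[ℂ] 𝒢.C0s where
  toFun e := ⟨e.toBCF.compContinuous ⟨𝒢.s, 𝒢.continuous_s⟩, by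
    intro ε hε
    have h : ∀ᶠ x in cocompact X, ‖e x‖ < ε := by
      have := (zero_at_infty e).norm
      rw [norm_zero] at this
      exact this.eventually_lt_const hε
    obtain ⟨K, hK, hKs⟩ := mem_cocompact.1 h
    exact ⟨K, hK, fun γ hγ => hKs hγ⟩⟩
  map_smul' _ _ := rfl
  map_zero' := rfl
  map_add' _ _ := rfl
  map_mul' _ _ := rfl
  map_star' _ := rfl

/-- The function `g ∈ C₀ˢ(𝒢)` is a translate of `f ∈ C₀ˢ(𝒢)` along the arrow `γ`: for all arrows
`δ` close to `γ` and all `η` with `s η = r δ` one has `g η = f (η δ)`. Since `𝒢` is étale, the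
arrows `δ` near `γ` form a local bisection, which is parametrized by `r δ`; so this says that
the class of `g` in the fibre `C₀ˢ(𝒢)(r γ)` is `α_γ` of the class of `f` in the fibre
`C₀ˢ(𝒢)(s γ)`, where `α` is the canonical action of `𝒢` on `C₀ˢ(𝒢)`. -/
def IsTranslate (𝒢 : TopologicalGroupoid G X) (γ : G) (f g : 𝒢.C0s) : Prop :=
  ∀ᶠ δ in 𝓝 γ, ∀ (η : G) (h : 𝒢.s η = 𝒢.r δ), g.1 η = f.1 (𝒢.mul ⟨(η, δ), h⟩)

section Aux

variable (𝒢 : TopologicalGroupoid G X)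

theorem isClosedEmbedding_unit [T2Space G] : IsClosedEmbedding 𝒢.unit :=
  Topology.IsClosedEmbedding.of_continuous_injective_isClosedMap 𝒢.continuous_unit
    (Function.LeftInverse.injective 𝒢.s_unit) (by
      intro C hC
      have : 𝒢.unit '' C = {γ | 𝒢.unit (𝒢.s γ) = γ} ∩ 𝒢.s ⁻¹' C := by
        ext γ
        constructor
        · rintro ⟨x, hx, rfl⟩
          simp [𝒢.s_unit, hx]
        · rintro ⟨h1, h2⟩
          exact ⟨_, h2, h1⟩
      rw [this]
      exact (isClosed_eq (𝒢.continuous_unit.comp 𝒢.continuous_s) continuous_id).inter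
        (hC.preimage 𝒢.continuous_s))

theorem t2Space_units (𝒢 : TopologicalGroupoid G X) [T2Space G] : T2Space X :=
  𝒢.isClosedEmbedding_unit.isEmbedding.t2Space

theorem locallyCompactSpace_units (𝒢 : TopologicalGroupoid G X) [T2Space G]
    [LocallyCompactSpace G] : LocallyCompactSpace X :=
  𝒢.isClosedEmbedding_unit.locallyCompactSpace

theorem exists_bump [T2Space X] [LocallyCompactSpace X] {K V : Set X} (hK : IsCompact K)
    (hV : IsOpen V) (hKV : K ⊆ V) :
    ∃ e : C₀(X, ℂ), (∀ x ∈ K, e x = 1) ∧ IsCompact (tsupport e) ∧ tsupport e ⊆ V ∧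
      ∀ x, ‖e x‖ ≤ 1 := by
  obtain ⟨f, hf1, hf2, hf3, hf4⟩ := exists_continuousMap_one_of_isCompact_subset_isOpen hK hV hKV
  have hsupp : tsupport (fun x => (f x : ℂ)) = tsupport f := by
    simp only [tsupport]
    congr 1
    ext x
    simp
  have hc : HasCompactSupport (fun x => (f x : ℂ)) := by
    rw [HasCompactSupport, hsupp]; exact hf2
  refine ⟨⟨⟨fun x => (f x : ℂ), by fun_prop⟩, hc.is_zero_at_infty⟩, ?_, ?_, ?_, ?_⟩
  · intro x hx
    have := hf1 hx
    simp only [Pi.one_apply] at this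
    simp [this]
  · exact hc
  · exact hsupp.trans_subset hf3
  · intro x
    have := hf4 x
    simp only [ZeroAtInftyContinuousMap.coe_mk, Complex.norm_real, Real.norm_eq_abs]
    rw [abs_of_nonneg this.1]
    exact this.2

theorem sStar_apply (e : C₀(X, ℂ)) (γ : G) : (𝒢.sStar e).1 γ = e (𝒢.s γ) := rfl

theorem C0s_ext {f g : 𝒢.C0s} (h : ∀ γ, f.1 γ = g.1 γ) : f = g :=
  Subtype.ext (BoundedContinuousFunction.ext h)

theorem C0s_mul_apply (f g : 𝒢.C0s) (γ : G) : (f * g).1 γ = f.1 γ * g.1 γ := rfl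

/-- For a character `χ` of `C₀ˢ(𝒢)` there is a point `x` at which the kernel of `χ ∘ s^*`
vanishes. -/
theorem exists_common_zero [T2Space X] [LocallyCompactSpace X] (χ : 𝒢.Beta) :
    ∃ x : X, ∀ e : C₀(X, ℂ), χ (𝒢.sStar e) = 0 → e x = 0 := by
  by_contra! hcon
  choose e he hex using hcon
  obtain ⟨f, hf⟩ : ∃ f, χ f ≠ 0 := by
    by_contra! h
    exact χ.2.1 (ContinuousLinearMap.ext h)
  -- a cut-off of `f`, still not in the kernel
  have hcut : ∃ b : C₀(X, ℂ), IsCompact (tsupport b) ∧ χ (𝒢.sStar b * f) ≠ 0 := by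
    have hcont : Continuous (χ : 𝒢.C0s → ℂ) := map_continuous χ
    have hopen : IsOpen {g : 𝒢.C0s | χ g ≠ 0} := isOpen_ne_fun hcont continuous_const
    obtain ⟨ε, hε, hball⟩ := Metric.isOpen_iff.1 hopen f hf
    obtain ⟨K, hK, hfK⟩ := f.2 (ε / 3) (by positivity)
    obtain ⟨b, hb1, hb2, -, hb4⟩ := exists_bump hK isOpen_univ (subset_univ K)
    refine ⟨b, hb2, hball ?_⟩
    rw [Metric.mem_ball, dist_eq_norm]
    have hn : ‖(𝒢.sStar b * f - f).1‖ ≤ 2 * (ε / 3) := by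
      rw [BoundedContinuousFunction.norm_le (by positivity)]
      intro γ
      change ‖b (𝒢.s γ) * f.1 γ - f.1 γ‖ ≤ _
      by_cases hγ : 𝒢.s γ ∈ K
      · rw [hb1 _ hγ, one_mul, sub_self, norm_zero]; positivity
      · have h1 := hfK γ hγ
        have h2 : ‖b (𝒢.s γ) * f.1 γ‖ ≤ 1 * ‖f.1 γ‖ := by
          rw [norm_mul]; gcongr; exact hb4 _
        calc _ ≤ ‖b (𝒢.s γ) * f.1 γ‖ + ‖f.1 γ‖ := norm_sub_le _ _
          _ ≤ _ := by linarith
    calc ‖𝒢.sStar b * f - f‖ = ‖(𝒢.sStar b * f - f).1‖ := rfl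
      _ < ε := by linarith
  obtain ⟨b, hbc, hb⟩ := hcut
  -- a function in the kernel which is positive on the support of `b`
  obtain ⟨t, ht⟩ := hbc.elim_finite_subcover (fun x => {y | e x y ≠ 0})
    (fun x => isOpen_ne_fun (map_continuous (e x)) continuous_const)
    (fun x _ => mem_iUnion.2 ⟨x, hex x⟩)
  set h : C₀(X, ℂ) := ∑ x ∈ t, star (e x) * e x with hh
  have hχh : χ (𝒢.sStar h) = 0 := by
    rw [hh, map_sum, map_sum]
    refine Finset.sum_eq_zero fun x _ => ?_
    rw [map_mul, map_mul, he, mul_zero]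
  let hr : X → ℝ := fun y => ∑ x ∈ t, ‖e x y‖ ^ 2
  have hrc : Continuous hr := by
    refine continuous_finsetSum _ fun x _ => ?_
    exact ((map_continuous (e x)).norm).pow 2
  have hval : ∀ y, h y = (hr y : ℂ) := by
    intro y
    have : h y = ∑ x ∈ t, (star (e x) * e x) y := by
      let ev : C₀(X, ℂ) →+ ℂ :=
        { toFun := fun a => a y, map_zero' := rfl, map_add' := fun _ _ => rfl }
      exact map_sum ev _ t
    rw [this]
    simp only [hr, Complex.ofReal_sum]
    refine Finset.sum_congr rfl fun x _ => ?_
    change (starRingEnd ℂ) (e x y) * e x y = _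
    rw [mul_comm, Complex.mul_conj, Complex.normSq_eq_norm_sq]
  have hpos : ∀ y ∈ tsupport b, 0 < hr y := by
    intro y hy
    obtain ⟨x, hx⟩ := mem_iUnion.1 (ht hy)
    obtain ⟨hxt, hxy⟩ := mem_iUnion.1 hx
    exact Finset.sum_pos' (fun _ _ => by positivity)
      ⟨x, hxt, by have := norm_pos_iff.2 hxy; positivity⟩
  obtain ⟨m, hm, hmle⟩ : ∃ m : ℝ, 0 < m ∧ ∀ y ∈ tsupport b, m ≤ hr y := by
    rcases (tsupport b).eq_empty_or_nonempty with h0 | h0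
    · exact ⟨1, one_pos, by simp [h0]⟩
    · obtain ⟨y, hy, hmin⟩ := hbc.exists_isMinOn h0 hrc.continuousOn
      exact ⟨hr y, hpos y hy, fun z hz => hmin hz⟩
  let q : C₀(X, ℂ) := ⟨⟨fun y => b y * ((max (hr y) m)⁻¹ : ℝ), by
    refine (map_continuous b).mul (Complex.continuous_ofReal.comp ?_)
    exact (hrc.max continuous_const).inv₀ fun y => (lt_max_of_lt_right hm).ne'⟩, by
    refine HasCompactSupport.is_zero_at_infty ?_
    exact HasCompactSupport.mul_right hbc⟩
  have hfac : 𝒢.sStar b = 𝒢.sStar h * 𝒢.sStar q := by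
    rw [← map_mul]
    congr 1
    ext y
    change b y = h y * (b y * ((max (hr y) m)⁻¹ : ℝ))
    by_cases hy : y ∈ tsupport b
    · rw [max_eq_left (hmle y hy), hval]
      have h1 : (hr y : ℂ) ≠ 0 := Complex.ofReal_ne_zero.2 (hpos y hy).ne'
      rw [Complex.ofReal_inv, mul_left_comm, mul_inv_cancel₀ h1, mul_one]
    · rw [image_eq_zero_of_notMem_tsupport hy]; simp
  apply hb
  rw [hfac, map_mul, map_mul, hχh, zero_mul, zero_mul]

/-- A character of `C₀ˢ(𝒢)` restricts along `s^*` to the evaluation at a unique point of `X`. -/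
theorem exists_anchor [T2Space X] [LocallyCompactSpace X] (χ : 𝒢.Beta) :
    ∃ x : X, ∀ e : C₀(X, ℂ), χ (𝒢.sStar e) = e x := by
  obtain ⟨x, hx⟩ := 𝒢.exists_common_zero χ
  obtain ⟨e, he1, -⟩ := exists_bump (isCompact_singleton (x := x)) isOpen_univ (subset_univ _)
  have hex : e x = 1 := he1 x rfl
  have key : ∀ a : C₀(X, ℂ), χ (𝒢.sStar e) * a x = χ (𝒢.sStar a) := by
    intro a
    have h := hx (χ (𝒢.sStar e) • a - χ (𝒢.sStar a) • e) (by
      rw [map_sub, map_smul, map_smul, map_sub, map_smul, map_smul, smul_eq_mul, smul_eq_mul,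
        mul_comm, sub_self])
    have h' : χ (𝒢.sStar e) * a x - χ (𝒢.sStar a) * e x = 0 := h
    rw [hex, mul_one] at h'
    exact sub_eq_zero.1 h'
  have hne : χ (𝒢.sStar e) ≠ 0 := by
    intro h0
    rw [hx e h0] at hex
    exact zero_ne_one hex
  have h1 : χ (𝒢.sStar e) = 1 := by
    have := key (e * e)
    rw [map_mul, map_mul] at this
    have h2 : (e * e) x = 1 := by
      change e x * e x = 1
      rw [hex, one_mul]
    rw [h2] at this
    exact mul_left_cancel₀ hne this.symm
  exact ⟨x, fun a => by rw [← key a, h1, one_mul]⟩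

theorem eq_of_forall_C0 [T2Space X] [LocallyCompactSpace X] {x y : X}
    (h : ∀ e : C₀(X, ℂ), e x = e y) : x = y := by
  by_contra hne
  obtain ⟨e, he1, -, he3, -⟩ := exists_bump (isCompact_singleton (x := x))
    (isOpen_compl_singleton (x := y)) (by simpa using Ne.symm hne)
  have h1 : e x = 1 := he1 x rfl
  have h2 : e y = 0 := image_eq_zero_of_notMem_tsupport fun hy => he3 hy rfl
  rw [h, h2] at h1
  exact zero_ne_one h1

theorem mul_congr {p q : {p : G × G // 𝒢.s p.1 = 𝒢.r p.2}} (h₁ : p.1.1 = q.1.1)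
    (h₂ : p.1.2 = q.1.2) : 𝒢.mul p = 𝒢.mul q :=
  congrArg _ (Subtype.ext (Prod.ext h₁ h₂))

variable {𝒢}

theorem exists_translate [T2Space X] [LocallyCompactSpace X] (h𝒢 : 𝒢.IsEtale) (γ : G)
    (f : 𝒢.C0s) : ∃ g : 𝒢.C0s, 𝒢.IsTranslate γ f g ∧ ‖g‖ ≤ ‖f‖ := by
  classical
  obtain ⟨e, heγ, her⟩ := h𝒢.r_localHomeo γ
  have hrγ : 𝒢.r γ ∈ e.target := by rw [her]; exact e.map_source heγ
  obtain ⟨L, hL, hγL, hLV⟩ := exists_compact_subset e.open_target hrγ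
  obtain ⟨b, hb1, hb2, hb3, hb4⟩ := exists_bump hL e.open_target hLV
  have hcomp : ∀ x ∈ e.target, x = 𝒢.r (e.symm x) := fun x hx => by
    rw [her, e.right_inv hx]
  let g : G → ℂ := fun η => if h : 𝒢.s η = 𝒢.r (e.symm (𝒢.s η)) then
    b (𝒢.s η) * f.1 (𝒢.mul ⟨(η, e.symm (𝒢.s η)), h⟩) else 0
  have hg0 : ∀ η, 𝒢.s η ∉ tsupport b → g η = 0 := by
    intro η hη
    simp only [g]
    split_ifs
    · rw [image_eq_zero_of_notMem_tsupport hη, zero_mul]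
    · rfl
  have hgn : ∀ η, ‖g η‖ ≤ ‖f‖ := by
    intro η
    simp only [g]
    split_ifs with h
    · rw [norm_mul]
      calc _ ≤ 1 * ‖f.1‖ := by
            gcongr
            · exact hb4 _
            · exact f.1.norm_coe_le_norm _
        _ = ‖f‖ := one_mul _
    · simp
  have hgc : Continuous g := by
    rw [continuous_iff_continuousAt]
    intro η
    by_cases hη : 𝒢.s η ∈ tsupport b
    · have hW : IsOpen (𝒢.s ⁻¹' e.target) := e.open_target.preimage 𝒢.continuous_s
      refine ContinuousOn.continuousAt (s := 𝒢.s ⁻¹' e.target) ?_ (hW.mem_nhds (hb3 hη))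
      rw [continuousOn_iff_continuous_domRestrict]
      have hrest : (𝒢.s ⁻¹' e.target).domRestrict g = fun w =>
          b (𝒢.s w.1) * f.1 (𝒢.mul ⟨(w.1, e.symm (𝒢.s w.1)), hcomp _ w.2⟩) := by
        funext w
        simp only [Set.domRestrict_apply, g]
        rw [dif_pos (hcomp _ w.2)]
      rw [hrest]
      have h1 : Continuous fun w : 𝒢.s ⁻¹' e.target => 𝒢.s w.1 :=
        𝒢.continuous_s.comp continuous_subtype_val
      have h2 : Continuous fun w : 𝒢.s ⁻¹' e.target => e.symm (𝒢.s w.1) :=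
        e.continuousOn_symm.comp_continuous h1 fun w => w.2
      refine ((map_continuous b).comp h1).mul (f.1.continuous.comp (𝒢.continuous_mul.comp ?_))
      exact (continuous_subtype_val.prodMk h2).subtype_mk _
    · have hev : g =ᶠ[𝓝 η] fun _ => 0 := by
        have : 𝒢.s ⁻¹' (tsupport b)ᶜ ∈ 𝓝 η :=
          ((isClosed_tsupport b).isOpen_compl.preimage 𝒢.continuous_s).mem_nhds hη
        filter_upwards [this] with ξ hξ using hg0 ξ hξ
      exact continuousAt_const.congr hev.symm
  refine ⟨⟨BoundedContinuousFunction.ofNormedAddCommGroup g hgc ‖f‖ hgn, fun ε hε =>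
    ⟨tsupport b, hb2, fun η hη => ?_⟩⟩, ?_, ?_⟩
  · change ‖g η‖ < ε
    rw [hg0 η hη, norm_zero]
    exact hε
  · have hN1 : ∀ᶠ δ in 𝓝 γ, δ ∈ e.source := e.open_source.mem_nhds heγ
    have hN2 : ∀ᶠ δ in 𝓝 γ, 𝒢.r δ ∈ interior L :=
      𝒢.continuous_r.continuousAt.eventually (isOpen_interior.mem_nhds hγL)
    filter_upwards [hN1, hN2] with δ hδ1 hδ2 η hη
    change g η = _
    have hs : e.symm (𝒢.s η) = δ := by rw [hη, her, e.left_inv hδ1]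
    have hd : 𝒢.s η = 𝒢.r (e.symm (𝒢.s η)) := by rw [hs]; exact hη
    simp only [g]
    have hb : b (𝒢.s η) = 1 := by rw [hη]; exact hb1 _ (interior_subset hδ2)
    rw [dif_pos hd, hb, one_mul]
    congr 1
    exact 𝒢.mul_congr rfl hs
  · exact (BoundedContinuousFunction.norm_le (norm_nonneg _)).2 hgn

/-- The set of ranges of arrows near `γ` contains an open neighbourhood of `r γ`. -/
theorem exists_open_range (h𝒢 : 𝒢.IsEtale) {γ : G} {P : G → Prop} (hP : ∀ᶠ δ in 𝓝 γ, P δ) :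
    ∃ V : Set X, IsOpen V ∧ 𝒢.r γ ∈ V ∧ ∀ x ∈ V, ∃ δ, P δ ∧ 𝒢.r δ = x := by
  have h := h𝒢.r_localHomeo.isOpenMap.image_mem_nhds hP
  obtain ⟨V, hV, hVo, hx⟩ := mem_nhds_iff.1 h
  exact ⟨V, hVo, hx, fun x hx => hV hx⟩

theorem translate_unique [T2Space X] [LocallyCompactSpace X] (h𝒢 : 𝒢.IsEtale) {γ : G}
    {f g g' : 𝒢.C0s} (hg : 𝒢.IsTranslate γ f g) (hg' : 𝒢.IsTranslate γ f g') {χ : 𝒢.Beta}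
    (hχ : ∀ e, χ (𝒢.sStar e) = e (𝒢.r γ)) : χ g = χ g' := by
  obtain ⟨V, hV, hγV, hVN⟩ := exists_open_range h𝒢 (hg.and hg')
  obtain ⟨b, hb1, -, hb3, -⟩ := exists_bump (isCompact_singleton (x := 𝒢.r γ)) hV (by simpa)
  have key : 𝒢.sStar b * g = 𝒢.sStar b * g' := by
    refine 𝒢.C0s_ext fun η => ?_
    rw [C0s_mul_apply, C0s_mul_apply, sStar_apply]
    by_cases hη : 𝒢.s η ∈ V
    · obtain ⟨δ, ⟨h1, h2⟩, hδ⟩ := hVN _ hη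
      rw [h1 η hδ.symm, h2 η hδ.symm]
    · rw [image_eq_zero_of_notMem_tsupport fun h => hη (hb3 h), zero_mul, zero_mul]
  have := congrArg χ key
  rwa [map_mul, map_mul, hχ, hb1 _ rfl, one_mul, one_mul] at this

theorem translate_sStar [T2Space X] [LocallyCompactSpace X] (h𝒢 : 𝒢.IsEtale) {γ : G}
    {e : C₀(X, ℂ)} {g : 𝒢.C0s} (hg : 𝒢.IsTranslate γ (𝒢.sStar e) g) {χ : 𝒢.Beta}
    (hχ : ∀ e, χ (𝒢.sStar e) = e (𝒢.r γ)) : χ g = e (𝒢.s γ) := by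
  obtain ⟨V, hV, hγV, hVN⟩ := exists_open_range h𝒢 hg
  obtain ⟨b, hb1, hb2, hb3, -⟩ := exists_bump (isCompact_singleton (x := 𝒢.r γ)) hV (by simpa)
  let c : C₀(X, ℂ) := ⟨⟨fun x => b x * g.1 (𝒢.unit x),
    (map_continuous b).mul (g.1.continuous.comp 𝒢.continuous_unit)⟩,
    HasCompactSupport.is_zero_at_infty (HasCompactSupport.mul_right hb2)⟩
  have hval : ∀ η δ, (∀ (η : G) (h : 𝒢.s η = 𝒢.r δ),
      g.1 η = (𝒢.sStar e).1 (𝒢.mul ⟨(η, δ), h⟩)) → 𝒢.s η = 𝒢.r δ → g.1 η = e (𝒢.s δ) := by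
    intro η δ h1 h2
    rw [h1 η h2, sStar_apply, 𝒢.s_mul]
  have key : 𝒢.sStar b * g = 𝒢.sStar c := by
    refine 𝒢.C0s_ext fun η => ?_
    rw [C0s_mul_apply, sStar_apply, sStar_apply]
    change _ = b (𝒢.s η) * g.1 (𝒢.unit (𝒢.s η))
    by_cases hη : 𝒢.s η ∈ V
    · obtain ⟨δ, h1, hδ⟩ := hVN _ hη
      rw [hval η δ h1 hδ.symm, hval _ δ h1 (by rw [𝒢.s_unit, hδ])]
    · rw [image_eq_zero_of_notMem_tsupport fun h => hη (hb3 h), zero_mul, zero_mul]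
  have h := congrArg χ key
  rw [map_mul, hχ, hχ, hb1 _ rfl, one_mul] at h
  rw [h]
  change b (𝒢.r γ) * g.1 (𝒢.unit (𝒢.r γ)) = _
  rw [hb1 _ rfl, one_mul]
  exact hval _ γ hg.self_of_nhds (𝒢.s_unit _)

theorem exists_act [T2Space X] [LocallyCompactSpace X] (h𝒢 : 𝒢.IsEtale) (χ : 𝒢.Beta) (γ : G)
    (hχ : ∀ e, χ (𝒢.sStar e) = e (𝒢.r γ)) :
    ∃ ψ : 𝒢.Beta, ∀ f g : 𝒢.C0s, 𝒢.IsTranslate γ f g → ψ f = χ g := by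
  choose T hT hTn using exists_translate h𝒢 γ
  have huniq : ∀ f g, 𝒢.IsTranslate γ f g → χ (T f) = χ g := fun f g hg =>
    translate_unique h𝒢 (hT f) hg hχ
  have hadd : ∀ f g, 𝒢.IsTranslate γ (f + g) (T f + T g) := fun f g => by
    filter_upwards [hT f, hT g] with δ h1 h2 η hη
    change (T f).1 η + (T g).1 η = f.1 _ + g.1 _
    rw [h1 η hη, h2 η hη]
  have hmul : ∀ f g, 𝒢.IsTranslate γ (f * g) (T f * T g) := fun f g => by
    filter_upwards [hT f, hT g] with δ h1 h2 η hη
    rw [C0s_mul_apply, C0s_mul_apply, h1 η hη, h2 η hη]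
  have hsmul : ∀ (c : ℂ) f, 𝒢.IsTranslate γ (c • f) (c • T f) := fun c f => by
    filter_upwards [hT f] with δ h1 η hη
    change c • (T f).1 η = c • f.1 _
    rw [h1 η hη]
  let L : 𝒢.C0s →ₗ[ℂ] ℂ :=
    { toFun := fun f => χ (T f)
      map_add' := fun f g => by rw [huniq _ _ (hadd f g), map_add]
      map_smul' := fun c f => by rw [huniq _ _ (hsmul c f), map_smul]; rfl }
  let χL : 𝒢.C0s →L[ℂ] ℂ := WeakDual.CharacterSpace.toCLM χ
  let Lc : 𝒢.C0s →L[ℂ] ℂ := L.mkContinuous ‖χL‖ fun f => by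
    calc ‖χL (T f)‖ ≤ ‖χL‖ * ‖T f‖ := χL.le_opNorm _
      _ ≤ ‖χL‖ * ‖f‖ := by gcongr; exact hTn f
  refine ⟨⟨(Lc : WeakDual ℂ 𝒢.C0s), ?_, ?_⟩, fun f g hg => huniq f g hg⟩
  · intro h0
    obtain ⟨e, he, -⟩ := exists_bump (isCompact_singleton (x := 𝒢.s γ)) isOpen_univ
      (subset_univ _)
    have h1 : χ (T (𝒢.sStar e)) = 1 := by
      rw [translate_sStar h𝒢 (hT _) hχ, he _ rfl]
    have h2 : χ (T (𝒢.sStar e)) = 0 := DFunLike.congr_fun h0 (𝒢.sStar e)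
    exact one_ne_zero (h1.symm.trans h2)
  · intro f g
    change χ (T (f * g)) = χ (T f) * χ (T g)
    rw [huniq _ _ (hmul f g), map_mul]

theorem isTranslate_unit (h𝒢 : 𝒢.IsEtale) (x : X) (f : 𝒢.C0s) :
    𝒢.IsTranslate (𝒢.unit x) f f := by
  obtain ⟨e, hex, hes⟩ := h𝒢.s_localHomeo (𝒢.unit x)
  have h1 : ∀ᶠ δ in 𝓝 (𝒢.unit x), δ ∈ e.source := e.open_source.mem_nhds hex
  have h2 : ∀ᶠ δ in 𝓝 (𝒢.unit x), 𝒢.unit (𝒢.s δ) ∈ e.source :=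
    (𝒢.continuous_unit.comp 𝒢.continuous_s).continuousAt.eventually
      (e.open_source.mem_nhds (by simpa [𝒢.s_unit] using hex))
  filter_upwards [h1, h2] with δ hδ1 hδ2 η hη
  have hδ : 𝒢.unit (𝒢.s δ) = δ := e.injOn hδ2 hδ1 (by rw [← hes, 𝒢.s_unit])
  have hr : 𝒢.s η = 𝒢.s δ := by rw [hη, ← hδ, 𝒢.r_unit, 𝒢.s_unit]
  congr 1
  exact (𝒢.mul_unit η).symm.trans (𝒢.mul_congr rfl ((congrArg 𝒢.unit hr).trans hδ))

theorem isTranslate_mul (h𝒢 : 𝒢.IsEtale) {γ η : G} (h : 𝒢.s γ = 𝒢.r η) {f g g' : 𝒢.C0s}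
    (hg' : 𝒢.IsTranslate η f g') (hg : 𝒢.IsTranslate γ g' g) :
    𝒢.IsTranslate (𝒢.mul ⟨(γ, η), h⟩) f g := by
  obtain ⟨e, heγ, her⟩ := h𝒢.r_localHomeo γ
  have hcomp : ∀ x ∈ e.target, 𝒢.r (e.symm x) = x := fun x hx => by
    rw [her, e.right_inv hx]
  have hW : IsOpen (𝒢.r ⁻¹' e.target) := e.open_target.preimage 𝒢.continuous_r
  have hmem : 𝒢.mul ⟨(γ, η), h⟩ ∈ 𝒢.r ⁻¹' e.target := by
    rw [mem_preimage, 𝒢.r_mul]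
    exact (congrFun her γ) ▸ e.map_source heγ
  let F₁ : 𝒢.r ⁻¹' e.target → G := fun w => e.symm (𝒢.r w.1)
  have hF₁ : Continuous F₁ :=
    e.continuousOn_symm.comp_continuous (𝒢.continuous_r.comp continuous_subtype_val) fun w => w.2
  have hrF : ∀ w, 𝒢.r (F₁ w) = 𝒢.r w.1 := fun w => hcomp _ w.2
  let F₂ : 𝒢.r ⁻¹' e.target → G := fun w =>
    𝒢.mul ⟨(𝒢.inv (F₁ w), w.1), (𝒢.s_inv _).trans (hrF w)⟩
  have hF₂ : Continuous F₂ := 𝒢.continuous_mul.comp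
    (((𝒢.continuous_inv.comp hF₁).prodMk continuous_subtype_val).subtype_mk _)
  have hF₁0 : F₁ ⟨_, hmem⟩ = γ := by
    change e.symm (𝒢.r _) = γ
    rw [𝒢.r_mul]
    exact (congrArg e.symm (congrFun her γ)).trans (e.left_inv heγ)
  have hF₂0 : F₂ ⟨_, hmem⟩ = η := by
    have h1 : F₂ ⟨_, hmem⟩ = 𝒢.mul ⟨(𝒢.inv γ, 𝒢.mul ⟨(γ, η), h⟩),
        (𝒢.s_inv _).trans (𝒢.r_mul ⟨(γ, η), h⟩).symm⟩ :=
      𝒢.mul_congr (congrArg 𝒢.inv hF₁0) rfl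
    rw [h1, 𝒢.mul_assoc _ _ _ (𝒢.s_inv γ) h]
    exact Eq.trans (b := 𝒢.mul ⟨(𝒢.unit (𝒢.r η), η), 𝒢.s_unit _⟩)
      (𝒢.mul_congr ((𝒢.inv_mul γ).trans (congrArg 𝒢.unit h)) rfl) (𝒢.unit_mul η)
  have h1 : ∀ᶠ w in 𝓝 (⟨_, hmem⟩ : 𝒢.r ⁻¹' e.target), ∀ (ξ : G) (hξ : 𝒢.s ξ = 𝒢.r (F₁ w)),
      g.1 ξ = g'.1 (𝒢.mul ⟨(ξ, F₁ w), hξ⟩) := by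
    refine hF₁.continuousAt.eventually (p := fun a => ∀ (ξ : G) (hξ : 𝒢.s ξ = 𝒢.r a),
      g.1 ξ = g'.1 (𝒢.mul ⟨(ξ, a), hξ⟩)) ?_
    rw [hF₁0]
    exact hg
  have h2 : ∀ᶠ w in 𝓝 (⟨_, hmem⟩ : 𝒢.r ⁻¹' e.target), ∀ (ξ : G) (hξ : 𝒢.s ξ = 𝒢.r (F₂ w)),
      g'.1 ξ = f.1 (𝒢.mul ⟨(ξ, F₂ w), hξ⟩) := by
    refine hF₂.continuousAt.eventually (p := fun a => ∀ (ξ : G) (hξ : 𝒢.s ξ = 𝒢.r a),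
      g'.1 ξ = f.1 (𝒢.mul ⟨(ξ, a), hξ⟩)) ?_
    rw [hF₂0]
    exact hg'
  have hmap := hW.isOpenEmbedding_subtypeVal.map_nhds_eq (⟨_, hmem⟩ : 𝒢.r ⁻¹' e.target)
  rw [IsTranslate, ← hmap, eventually_map]
  filter_upwards [h1, h2] with w hw1 hw2 ξ hξ
  have hξ1 : 𝒢.s ξ = 𝒢.r (F₁ w) := hξ.trans (hrF w).symm
  have h12 : 𝒢.s (F₁ w) = 𝒢.r (F₂ w) := by
    rw [𝒢.r_mul, 𝒢.r_inv]
  rw [hw1 ξ hξ1, hw2 _ ((𝒢.s_mul _).trans h12), ← 𝒢.mul_assoc ξ (F₁ w) (F₂ w) hξ1 h12]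
  congr 1
  refine 𝒢.mul_congr rfl ?_
  change 𝒢.mul ⟨(F₁ w, 𝒢.mul ⟨(𝒢.inv (F₁ w), w.1), _⟩), _⟩ = w.1
  rw [𝒢.mul_assoc _ _ _ (𝒢.r_inv (F₁ w)).symm ((𝒢.s_inv _).trans (hrF w))]
  exact Eq.trans (b := 𝒢.mul ⟨(𝒢.unit (𝒢.r w.1), w.1), 𝒢.s_unit _⟩)
    (𝒢.mul_congr ((𝒢.mul_inv _).trans (congrArg 𝒢.unit (hrF w))) rfl) (𝒢.unit_mul w.1)

theorem continuous_eval (f : 𝒢.C0s) : Continuous fun χ : 𝒢.Beta => χ f :=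
  (WeakDual.eval_continuous f).comp continuous_subtype_val

end Aux

section Beta

variable (𝒢 : TopologicalGroupoid G X) [T2Space G] [LocallyCompactSpace G]

theorem exists_betaAnchor (χ : 𝒢.Beta) : ∃ x : X, ∀ e : C₀(X, ℂ), χ (𝒢.sStar e) = e x :=
  have := 𝒢.t2Space_units
  have := 𝒢.locallyCompactSpace_units
  𝒢.exists_anchor χ

/-- The map `s̃ : β_X 𝒢 → X` induced by `s^* : C₀(X) → C₀ˢ(𝒢)`: the point `s̃ χ` is the unique
`x` such that `χ ∘ s^*` is the evaluation at `x`. -/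
noncomputable def betaAnchor (χ : 𝒢.Beta) : X :=
  Classical.choose (𝒢.exists_betaAnchor χ)

theorem betaAnchor_spec (χ : 𝒢.Beta) (e : C₀(X, ℂ)) : χ (𝒢.sStar e) = e (𝒢.betaAnchor χ) :=
  Classical.choose_spec (𝒢.exists_betaAnchor χ) e

theorem betaAnchor_eq {χ : 𝒢.Beta} {x : X} (h : ∀ e, χ (𝒢.sStar e) = e x) :
    𝒢.betaAnchor χ = x :=
  have := 𝒢.t2Space_units
  have := 𝒢.locallyCompactSpace_units
  eq_of_forall_C0 fun e => by rw [← betaAnchor_spec, h]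

theorem continuous_betaAnchor : Continuous 𝒢.betaAnchor := by
  have := 𝒢.t2Space_units
  have := 𝒢.locallyCompactSpace_units
  refine continuous_iff_continuousAt.2 fun χ => ?_
  intro V hV
  obtain ⟨U, hUV, hU, hχ⟩ := mem_nhds_iff.1 hV
  obtain ⟨b, hb1, -, hb3, -⟩ := exists_bump (isCompact_singleton (x := 𝒢.betaAnchor χ)) hU
    (by simpa)
  have h1 : χ (𝒢.sStar b) ≠ 0 := by rw [betaAnchor_spec, hb1 _ rfl]; exact one_ne_zero
  have h2 : ∀ᶠ ψ : 𝒢.Beta in 𝓝 χ, ψ (𝒢.sStar b) ≠ 0 :=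
    (continuous_eval _).continuousAt.eventually_ne h1
  change ∀ᶠ ψ in 𝓝 χ, 𝒢.betaAnchor ψ ∈ V
  filter_upwards [h2] with ψ hψ
  rw [betaAnchor_spec] at hψ
  exact hUV (hb3 (subset_tsupport b hψ))

variable {𝒢}

theorem exists_betaAct (h𝒢 : 𝒢.IsEtale) (p : {p : 𝒢.Beta × G // 𝒢.betaAnchor p.1 = 𝒢.r p.2}) :
    ∃ ψ : 𝒢.Beta, ∀ f g : 𝒢.C0s, 𝒢.IsTranslate p.1.2 f g → ψ f = p.1.1 g :=
  have := 𝒢.t2Space_units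
  have := 𝒢.locallyCompactSpace_units
  exists_act h𝒢 p.1.1 p.1.2 fun e => by rw [betaAnchor_spec, p.2]

/-- The right action of `𝒢` on `β_X 𝒢`: `χ · γ` is the unique character such that
`(χ · γ)(f) = χ(α_γ(f))` for all `f`, that is, `(χ · γ)(f) = χ(g)` whenever `g` represents
`α_γ(f)`. -/
noncomputable def betaAct (h𝒢 : 𝒢.IsEtale)
    (p : {p : 𝒢.Beta × G // 𝒢.betaAnchor p.1 = 𝒢.r p.2}) : 𝒢.Beta :=
  Classical.choose (exists_betaAct h𝒢 p)

theorem betaAct_spec (h𝒢 : 𝒢.IsEtale) (p : {p : 𝒢.Beta × G // 𝒢.betaAnchor p.1 = 𝒢.r p.2})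
    {f g : 𝒢.C0s} (h : 𝒢.IsTranslate p.1.2 f g) : betaAct h𝒢 p f = p.1.1 g :=
  Classical.choose_spec (exists_betaAct h𝒢 p) f g h

theorem exists_isTranslate (h𝒢 : 𝒢.IsEtale) (γ : G) (f : 𝒢.C0s) : ∃ g, 𝒢.IsTranslate γ f g :=
  have := 𝒢.t2Space_units
  have := 𝒢.locallyCompactSpace_units
  (exists_translate h𝒢 γ f).imp fun _ h => h.1

theorem betaAnchor_betaAct (h𝒢 : 𝒢.IsEtale)
    (p : {p : 𝒢.Beta × G // 𝒢.betaAnchor p.1 = 𝒢.r p.2}) :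
    𝒢.betaAnchor (betaAct h𝒢 p) = 𝒢.s p.1.2 := by
  have := 𝒢.t2Space_units
  have := 𝒢.locallyCompactSpace_units
  refine 𝒢.betaAnchor_eq fun e => ?_
  obtain ⟨g, hg⟩ := exists_isTranslate h𝒢 p.1.2 (𝒢.sStar e)
  rw [betaAct_spec h𝒢 p hg]
  exact translate_sStar h𝒢 hg fun e => by rw [betaAnchor_spec, p.2]

/-- The `𝒢`-space `β_X 𝒢`, for an étale locally compact Hausdorff groupoid `𝒢`. -/
noncomputable def betaAction (h𝒢 : 𝒢.IsEtale) : 𝒢.RightAction 𝒢.Beta where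
  anchor := 𝒢.betaAnchor
  act := betaAct h𝒢
  anchor_act := betaAnchor_betaAct h𝒢
  act_unit χ := WeakDual.CharacterSpace.ext fun f =>
    betaAct_spec h𝒢 ⟨(χ, _), _⟩ (isTranslate_unit h𝒢 _ f)
  act_act χ γ η h₁ h₂ := WeakDual.CharacterSpace.ext fun f => by
    obtain ⟨g', hg'⟩ := exists_isTranslate h𝒢 η f
    obtain ⟨g, hg⟩ := exists_isTranslate h𝒢 γ g'
    rw [betaAct_spec h𝒢 ⟨(_, η), _⟩ hg', betaAct_spec h𝒢 ⟨(χ, γ), h₁⟩ hg,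
      betaAct_spec h𝒢 ⟨(χ, _), _⟩ (isTranslate_mul h𝒢 h₂ hg' hg)]
  continuous_anchor := 𝒢.continuous_betaAnchor
  continuous_act := by
    refine Continuous.subtype_mk (WeakDual.continuous_of_continuous_eval fun f => ?_) _
    refine continuous_iff_continuousAt.2 fun p => ?_
    obtain ⟨g, hg⟩ := exists_isTranslate h𝒢 p.1.2 f
    have h1 : ∀ᶠ q : {p : 𝒢.Beta × G // 𝒢.betaAnchor p.1 = 𝒢.r p.2} in 𝓝 p,
        𝒢.IsTranslate q.1.2 f g :=
      (continuous_snd.comp continuous_subtype_val).continuousAt.eventually hg.eventually_nhds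
    have h2 : Continuous fun q : {p : 𝒢.Beta × G // 𝒢.betaAnchor p.1 = 𝒢.r p.2} => q.1.1 g :=
      (continuous_eval g).comp (continuous_fst.comp continuous_subtype_val)
    refine h2.continuousAt.congr ?_
    filter_upwards [h1] with q hq using (betaAct_spec h𝒢 q hq).symm

end Beta

end TopologicalGroupoid

/-! The section `σ` need not be equivariant, but its orbit map `φ γ = σ (r γ) · γ` from `G` to `Z`
is: it lies over `X` via `s`, and `φ (ηδ) = φ η · δ` because `r (ηδ) = r η`. The map sought is the
extension of `φ` to `β_X 𝒢`, obtained by Gelfand duality: for a character `χ`, the functional `h ↦ χ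
(h ∘ φ)` is multiplicative on `C₀(Z)`, and it is evaluation at a point `θ χ` of `Z` once it is known
to be nonzero. Properness of the anchor `π` gives this: for `e ∈ C₀(X)` the function `e ∘ π` lies in
`C₀(Z)`, and it pulls back to `e ∘ s`, where `χ` takes the value `e (s̃ χ)`.

To reuse the description of characters by points of the base, `C₀(Z)` is realised as `C₀ˢ` of the
groupoid having only identity arrows over `Z`; the point `θ χ` is then the anchor of the pulled-back
character (`comapBeta`, `extendBeta`).

Everything else is tested on functions. The identity `π ∘ θ = s̃` follows from `e ∘ π ∘ φ = e ∘ s`.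
Since `s̃` is proper by Banach–Alaoglu (`isProperMap_betaAnchor`) and `Z` is Hausdorff, `θ` is
proper. For equivariance, a function `h` on `Z` is translated along arrows near `γ` to a function
`k` (`exists_translate_of_isProperMap`); then `k ∘ φ` is a translate of `h ∘ φ`, and the definition
of `χ · γ` applies. -/

namespace TopologicalGroupoid

variable {G X : Type*} [TopologicalSpace G] [TopologicalSpace X]

/-! ### Functions on a space as functions on a groupoid. -/

/-- The groupoid with only identity arrows on a space `Z`. -/
def unitGroupoid (Z : Type*) [TopologicalSpace Z] : TopologicalGroupoid Z Z where
  s := id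
  r := id
  mul p := p.1.1
  unit := id
  inv := id
  r_mul _ := rfl
  s_mul p := p.2
  mul_assoc _ _ _ _ _ := rfl
  s_unit _ := rfl
  r_unit _ := rfl
  mul_unit _ := rfl
  unit_mul _ := rfl
  r_inv _ := rfl
  s_inv _ := rfl
  mul_inv _ := rfl
  inv_mul _ := rfl
  continuous_s := continuous_id
  continuous_r := continuous_id
  continuous_mul := continuous_fst.comp continuous_subtype_val
  continuous_unit := continuous_id
  continuous_inv := continuous_id

/-! ### Compactness in the spectrum and properness of its anchor map. -/

variable {𝒢 : TopologicalGroupoid G X}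

/-- Multiplicativity gives `|L f|² = |L (f²)| ≤ ‖L‖ ‖f‖²`, hence `‖L‖ ≤ √‖L‖`, which forces `‖L‖ ≤
1`. The argument uses neither a unit nor completeness. -/
theorem norm_apply_le (χ : 𝒢.Beta) (f : 𝒢.C0s) : ‖χ f‖ ≤ ‖f‖ := by
  set L : 𝒢.C0s →L[ℂ] ℂ := WeakDual.CharacterSpace.toCLM χ
  have h1 : ∀ f, ‖L f‖ ≤ √‖L‖ * ‖f‖ := fun f => by
    refine le_of_sq_le_sq ?_ (by positivity)
    have hsq : √‖L‖ ^ 2 = ‖L‖ := Real.sq_sqrt (norm_nonneg L)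
    rw [mul_pow, hsq, ← norm_pow, sq (L f)]
    calc ‖L f * L f‖ = ‖L (f * f)‖ := congrArg norm (map_mul χ f f).symm
      _ ≤ ‖L‖ * ‖f * f‖ := L.le_opNorm _
      _ ≤ ‖L‖ * ‖f‖ ^ 2 := by rw [sq]; gcongr; exact norm_mul_le f f
  have h2 : ‖L‖ ≤ √‖L‖ := L.opNorm_le_bound (Real.sqrt_nonneg _) h1
  have h3 : √‖L‖ ≤ 1 := by
    nlinarith [Real.sq_sqrt (norm_nonneg L), Real.sqrt_nonneg ‖L‖]
  calc ‖χ f‖ ≤ √‖L‖ * ‖f‖ := h1 f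
    _ ≤ ‖f‖ := mul_le_of_le_one_left (norm_nonneg _) h3

/-- By Banach–Alaoglu the unit ball is weak-* compact, and in it the characters together with `0`
form a closed set. The closed condition `φ b = 1` excludes `0`, the only possible limit of
characters that is not a character. -/
theorem isCompact_setOf_apply_eq_one (b : 𝒢.C0s) : IsCompact {χ : 𝒢.Beta | χ b = 1} := by
  rw [Topology.IsInducing.subtypeVal.isCompact_iff]
  have hball : IsCompact (WeakDual.toStrongDual ⁻¹' Metric.closedBall (0 : StrongDual ℂ 𝒢.C0s) 1) :=
    WeakDual.isCompact_closedBall 0 1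
  have hclosed : IsClosed {φ : WeakDual ℂ 𝒢.C0s | φ b = 1} :=
    isClosed_eq (WeakDual.eval_continuous b) continuous_const
  convert (hball.inter_right (WeakDual.CharacterSpace.union_zero_isClosed ℂ 𝒢.C0s)).inter_right
    hclosed using 1
  ext φ
  constructor
  · rintro ⟨χ, hχ, rfl⟩
    refine ⟨⟨?_, Or.inl χ.2⟩, hχ⟩
    refine (mem_closedBall_zero_iff (E := StrongDual ℂ 𝒢.C0s)).2 ?_
    exact ContinuousLinearMap.opNorm_le_bound _ zero_le_one fun f => by
      rw [one_mul]; exact norm_apply_le χ f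
  · rintro ⟨⟨-, hφ | hφ⟩, h1⟩
    · exact ⟨⟨φ, hφ⟩, h1, rfl⟩
    · rw [mem_singleton_iff.1 hφ] at h1
      exact absurd h1 zero_ne_one

theorem isProperMap_betaAnchor [T2Space G] [LocallyCompactSpace G]
    (𝒢 : TopologicalGroupoid G X) : IsProperMap 𝒢.betaAnchor := by
  have := 𝒢.t2Space_units
  have := 𝒢.locallyCompactSpace_units
  refine isProperMap_iff_isCompact_preimage.2 ⟨𝒢.continuous_betaAnchor, fun K hK => ?_⟩
  -- As `b = 1` on `K`, every character anchored in `K` takes the value `1` at `b ∘ s`.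
  obtain ⟨b, hb, -⟩ := exists_bump hK isOpen_univ (subset_univ K)
  refine (isCompact_setOf_apply_eq_one (𝒢.sStar b)).of_isClosed_subset
    (hK.isClosed.preimage 𝒢.continuous_betaAnchor) fun χ hχ => ?_
  rw [mem_ofPred_eq, betaAnchor_spec]
  exact hb _ hχ

/-! ### Extension of maps over `X` to the spectrum. -/

section Pullback

variable {Z : Type*} [TopologicalSpace Z]

/-- Composition with a map `φ : G → Z` over `X` sends the functions on `Z` vanishing at infinity to
`C₀ˢ(𝒢)`. -/
noncomputable def pullback {π : Z → X} (hπ : Continuous π) (φ : C(G, Z))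
    (hφ : ∀ γ, π (φ γ) = 𝒢.s γ) : (unitGroupoid Z).C0s →ₙₐ[ℂ] 𝒢.C0s where
  toFun f := ⟨f.1.compContinuous φ, fun ε hε => by
    obtain ⟨K, hK, hf⟩ := f.2 ε hε
    -- If `s γ = π (φ γ)` is outside `π '' K`, then `φ γ` is outside `K`; for this direction
    -- continuity of `π` suffices.
    exact ⟨π '' K, hK.image hπ, fun γ hγ => hf _ fun h => hγ ⟨_, h, hφ γ⟩⟩⟩
  map_smul' _ _ := rfl
  map_zero' := rfl
  map_add' _ _ := rfl
  map_mul' _ _ := rfl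

theorem norm_pullback_le {π : Z → X} (hπ : Continuous π) (φ : C(G, Z))
    (hφ : ∀ γ, π (φ γ) = 𝒢.s γ) (f : (unitGroupoid Z).C0s) : ‖pullback hπ φ hφ f‖ ≤ ‖f‖ :=
  (BoundedContinuousFunction.norm_le (norm_nonneg _)).2 fun γ => f.1.norm_coe_le_norm (φ γ)

/-- The composition `e ∘ π` of a function vanishing at infinity with a proper map. -/
noncomputable def compProper {π : Z → X} (hπ : IsProperMap π) (e : C₀(X, ℂ)) : C₀(Z, ℂ) where
  toFun z := e (π z)
  continuous_toFun := (map_continuous e).comp hπ.continuous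
  zero_at_infty' := (zero_at_infty e).comp fun _ hs => by
    obtain ⟨K, hK, hKs⟩ := mem_cocompact.1 hs
    exact mem_cocompact.2 ⟨π ⁻¹' K, hπ.isCompact_preimage hK, fun _ hz => hKs hz⟩

theorem pullback_sStar_compProper {π : Z → X} (hπ : IsProperMap π) (φ : C(G, Z))
    (hφ : ∀ γ, π (φ γ) = 𝒢.s γ) (e : C₀(X, ℂ)) :
    pullback hπ.continuous φ hφ ((unitGroupoid Z).sStar (compProper hπ e)) = 𝒢.sStar e :=
  𝒢.C0s_ext fun γ => congrArg e (hφ γ)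

/-- A map `φ : G → Z` over `X` induces a bounded functional on the functions on `Z`. -/
noncomputable def pullbackFunctional {π : Z → X} (hπ : Continuous π) (φ : C(G, Z))
    (hφ : ∀ γ, π (φ γ) = 𝒢.s γ) (χ : 𝒢.Beta) : (unitGroupoid Z).C0s →L[ℂ] ℂ :=
  LinearMap.mkContinuous
    { toFun := fun f => χ (pullback hπ φ hφ f)
      map_add' := fun f g => by rw [map_add, map_add]
      map_smul' := fun c f =>
        (congrArg χ (map_smul (pullback hπ φ hφ) c f)).trans (map_smul χ c _) }
    1 fun f => ((norm_apply_le χ _).trans (norm_pullback_le hπ φ hφ f)).trans_eq (one_mul _).symm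

theorem pullbackFunctional_apply {π : Z → X} (hπ : Continuous π) (φ : C(G, Z))
    (hφ : ∀ γ, π (φ γ) = 𝒢.s γ) (χ : 𝒢.Beta) (f : (unitGroupoid Z).C0s) :
    pullbackFunctional hπ φ hφ χ f = χ (pullback hπ φ hφ f) := rfl

theorem pullbackFunctional_mul {π : Z → X} (hπ : Continuous π) (φ : C(G, Z))
    (hφ : ∀ γ, π (φ γ) = 𝒢.s γ) (χ : 𝒢.Beta) (f g : (unitGroupoid Z).C0s) :
    pullbackFunctional hπ φ hφ χ (f * g) =
      pullbackFunctional hπ φ hφ χ f * pullbackFunctional hπ φ hφ χ g := by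
  simp only [pullbackFunctional_apply, map_mul]

variable [T2Space G] [LocallyCompactSpace G]

/-- This is where properness of `π` makes the pulled-back functional a character: `e ∘ π` vanishes
at infinity on `Z`, and the functional takes there the value `e (s̃ χ)`, which is `1` for a suitable
bump function `e`. -/
theorem pullbackFunctional_ne_zero {π : Z → X} (hπ : IsProperMap π) (φ : C(G, Z))
    (hφ : ∀ γ, π (φ γ) = 𝒢.s γ) (χ : 𝒢.Beta) :
    pullbackFunctional hπ.continuous φ hφ χ ≠ 0 := by
  have := 𝒢.t2Space_units
  have := 𝒢.locallyCompactSpace_units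
  intro h0
  obtain ⟨e, he, -⟩ := exists_bump (isCompact_singleton (x := 𝒢.betaAnchor χ)) isOpen_univ
    (subset_univ _)
  have h1 := DFunLike.congr_fun h0 ((unitGroupoid Z).sStar (compProper hπ e))
  rw [pullbackFunctional_apply, pullback_sStar_compProper, betaAnchor_spec, he _ rfl] at h1
  exact one_ne_zero h1

/-- A map `φ : G → Z` over `X`, with `Z` proper over `X`, induces a map of spectra. -/
noncomputable def comapBeta {π : Z → X} (hπ : IsProperMap π) (φ : C(G, Z))
    (hφ : ∀ γ, π (φ γ) = 𝒢.s γ) (χ : 𝒢.Beta) : (unitGroupoid Z).Beta :=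
  ⟨(pullbackFunctional hπ.continuous φ hφ χ : WeakDual ℂ (unitGroupoid Z).C0s),
    pullbackFunctional_ne_zero hπ φ hφ χ, pullbackFunctional_mul hπ.continuous φ hφ χ⟩

theorem continuous_comapBeta {π : Z → X} (hπ : IsProperMap π) (φ : C(G, Z))
    (hφ : ∀ γ, π (φ γ) = 𝒢.s γ) : Continuous (comapBeta hπ φ hφ) :=
  continuous_induced_rng.2 (WeakDual.continuous_of_continuous_eval fun f =>
    continuous_eval (pullback hπ.continuous φ hφ f))

variable [T2Space Z] [LocallyCompactSpace Z]

/-- The extension to `β_X 𝒢` of a map `φ : G → Z` over `X`, where `Z` is proper over `X`. -/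
noncomputable def extendBeta {π : Z → X} (hπ : IsProperMap π) (φ : C(G, Z))
    (hφ : ∀ γ, π (φ γ) = 𝒢.s γ) (χ : 𝒢.Beta) : Z :=
  (unitGroupoid Z).betaAnchor (comapBeta hπ φ hφ χ)

variable {π : Z → X} (hπ : IsProperMap π) (φ : C(G, Z)) (hφ : ∀ γ, π (φ γ) = 𝒢.s γ)

/-- The working description of the extension: since `C₀(Z)` separates the points of `Z`, these
values determine the image of `χ`. -/
theorem apply_extendBeta (χ : 𝒢.Beta) (h : C₀(Z, ℂ)) :
    h (extendBeta hπ φ hφ χ) = χ (pullback hπ.continuous φ hφ ((unitGroupoid Z).sStar h)) :=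
  ((unitGroupoid Z).betaAnchor_spec _ h).symm

theorem continuous_extendBeta : Continuous (extendBeta hπ φ hφ) :=
  (unitGroupoid Z).continuous_betaAnchor.comp (continuous_comapBeta hπ φ hφ)

theorem comp_extendBeta (χ : 𝒢.Beta) : π (extendBeta hπ φ hφ χ) = 𝒢.betaAnchor χ := by
  refine (𝒢.betaAnchor_eq fun e => ?_).symm
  rw [← pullback_sStar_compProper hπ φ hφ, ← apply_extendBeta]
  rfl

/-- A continuous map into a Hausdorff space is proper as soon as its composition with some
continuous map is; here the composition with `π` is `s̃`. -/
theorem isProperMap_extendBeta : IsProperMap (extendBeta hπ φ hφ) := by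
  refine isProperMap_of_comp_of_t2 (continuous_extendBeta hπ φ hφ) hπ.continuous ?_
  rw [show π ∘ extendBeta hπ φ hφ = 𝒢.betaAnchor from funext (comp_extendBeta hπ φ hφ)]
  exact 𝒢.isProperMap_betaAnchor

end Pullback

/-! ### Translation of functions, the orbit map and equivariance. -/

section Equivariance

variable {Z : Type*} [TopologicalSpace Z] (A : 𝒢.RightAction Z)

theorem act_congr {p q : {p : Z × G // A.anchor p.1 = 𝒢.r p.2}} (h₁ : p.1.1 = q.1.1)
    (h₂ : p.1.2 = q.1.2) : A.act p = A.act q :=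
  congrArg _ (Subtype.ext (Prod.ext h₁ h₂))

/-- A function on a proper `𝒢`-space can be translated along the arrows near `γ`. -/
theorem exists_translate_of_isProperMap [T2Space X] [LocallyCompactSpace X] (h𝒢 : 𝒢.IsEtale)
    (hA : IsProperMap A.anchor) (γ : G) (h : C₀(Z, ℂ)) :
    ∃ k : C₀(Z, ℂ), ∀ᶠ δ in 𝓝 γ, ∀ (z : Z) (hz : A.anchor z = 𝒢.r δ),
      k z = h (A.act ⟨(z, δ), hz⟩) := by
  classical
  obtain ⟨e, heγ, her⟩ := h𝒢.r_localHomeo γ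
  have hrγ : 𝒢.r γ ∈ e.target := by rw [her]; exact e.map_source heγ
  obtain ⟨L, hL, hγL, hLV⟩ := exists_compact_subset e.open_target hrγ
  obtain ⟨b, hb1, hb2, hb3, -⟩ := exists_bump hL e.open_target hLV
  have hcomp : ∀ x ∈ e.target, x = 𝒢.r (e.symm x) := fun x hx => by
    rw [her, e.right_inv hx]
  -- The inverse branch `e.symm` of `r` selects the arrow near `γ` whose range is `A.anchor z`, and
  -- `b` cuts off to the set where the branch is defined. The default value `0` does not break
  -- continuity: on `e.target` the condition holds, and off the support of `b` the function is zero
  -- anyway.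
  let k : Z → ℂ := fun z => if hz : A.anchor z = 𝒢.r (e.symm (A.anchor z)) then
    b (A.anchor z) * h (A.act ⟨(z, e.symm (A.anchor z)), hz⟩) else 0
  have hk0 : ∀ z, A.anchor z ∉ tsupport b → k z = 0 := by
    intro z hz
    simp only [k]
    split_ifs
    · rw [image_eq_zero_of_notMem_tsupport hz, zero_mul]
    · rfl
  have hkc : Continuous k := by
    rw [continuous_iff_continuousAt]
    intro z
    by_cases hz : A.anchor z ∈ tsupport b
    · have hW : IsOpen (A.anchor ⁻¹' e.target) := e.open_target.preimage A.continuous_anchor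
      refine ContinuousOn.continuousAt (s := A.anchor ⁻¹' e.target) ?_ (hW.mem_nhds (hb3 hz))
      rw [continuousOn_iff_continuous_domRestrict]
      have hrest : (A.anchor ⁻¹' e.target).domRestrict k = fun w =>
          b (A.anchor w.1) * h (A.act ⟨(w.1, e.symm (A.anchor w.1)), hcomp _ w.2⟩) := by
        funext w
        simp only [Set.domRestrict_apply, k]
        rw [dif_pos (hcomp _ w.2)]
      rw [hrest]
      have h1 : Continuous fun w : A.anchor ⁻¹' e.target => A.anchor w.1 :=
        A.continuous_anchor.comp continuous_subtype_val
      have h2 : Continuous fun w : A.anchor ⁻¹' e.target => e.symm (A.anchor w.1) :=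
        e.continuousOn_symm.comp_continuous h1 fun w => w.2
      refine ((map_continuous b).comp h1).mul ((map_continuous h).comp (A.continuous_act.comp ?_))
      exact (continuous_subtype_val.prodMk h2).subtype_mk _
    · have hev : k =ᶠ[𝓝 z] fun _ => 0 := by
        have : A.anchor ⁻¹' (tsupport b)ᶜ ∈ 𝓝 z :=
          ((isClosed_tsupport b).isOpen_compl.preimage A.continuous_anchor).mem_nhds hz
        filter_upwards [this] with w hw using hk0 w hw
      exact continuousAt_const.congr hev.symm
  have hkz : Tendsto k (cocompact Z) (𝓝 0) := by
    refine tendsto_const_nhds.congr' ?_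
    -- `k` vanishes off the preimage of `tsupport b`, which is compact because the anchor is proper.
    filter_upwards [(hA.isCompact_preimage hb2).compl_mem_cocompact] with z hz
    exact (hk0 z hz).symm
  refine ⟨⟨⟨k, hkc⟩, hkz⟩, ?_⟩
  -- For `δ` in `e.source` the branch returns `e.symm (r δ) = δ`, and for `r δ` in `L` the cut-off
  -- equals `1`.
  have hN1 : ∀ᶠ δ in 𝓝 γ, δ ∈ e.source := e.open_source.mem_nhds heγ
  have hN2 : ∀ᶠ δ in 𝓝 γ, 𝒢.r δ ∈ interior L :=
    𝒢.continuous_r.continuousAt.eventually (isOpen_interior.mem_nhds hγL)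
  filter_upwards [hN1, hN2] with δ hδ1 hδ2 z hz
  change k z = _
  have hs : e.symm (A.anchor z) = δ := by rw [hz, her, e.left_inv hδ1]
  have hd : A.anchor z = 𝒢.r (e.symm (A.anchor z)) := by rw [hs]; exact hz
  have hb : b (A.anchor z) = 1 := by rw [hz]; exact hb1 _ (interior_subset hδ2)
  simp only [k]
  rw [dif_pos hd, hb, one_mul]
  exact congrArg h (act_congr A rfl hs)

/-- The orbit map `γ ↦ σ (r γ) · γ` of a section `σ` of the anchor map. -/
def orbitMap (σ : C(X, Z)) (hσ : ∀ x, A.anchor (σ x) = x) : C(G, Z) where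
  toFun γ := A.act ⟨(σ (𝒢.r γ), γ), hσ _⟩
  continuous_toFun := A.continuous_act.comp
    (((σ.continuous.comp 𝒢.continuous_r).prodMk continuous_id).subtype_mk _)

theorem anchor_orbitMap (σ : C(X, Z)) (hσ : ∀ x, A.anchor (σ x) = x) (γ : G) :
    A.anchor (orbitMap A σ hσ γ) = 𝒢.s γ :=
  A.anchor_act _

/-- Since `r (ηδ) = r η`, both sides start from the same point `σ (r η)`, so associativity of the
action is enough and no equivariance of `σ` is needed. -/
theorem orbitMap_mul (σ : C(X, Z)) (hσ : ∀ x, A.anchor (σ x) = x) (η δ : G)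
    (h : 𝒢.s η = 𝒢.r δ) : orbitMap A σ hσ (𝒢.mul ⟨(η, δ), h⟩) =
      A.act ⟨(orbitMap A σ hσ η, δ), (anchor_orbitMap A σ hσ η).trans h⟩ :=
  Eq.trans (b := A.act ⟨(σ (𝒢.r η), 𝒢.mul ⟨(η, δ), h⟩),
      (hσ _).trans (𝒢.r_mul ⟨(η, δ), h⟩).symm⟩)
    (act_congr A (congrArg σ (𝒢.r_mul ⟨(η, δ), h⟩)) rfl)
    (A.act_act (σ (𝒢.r η)) η δ (hσ _) h).symm

/-- The extension to `β_X 𝒢` of an equivariant map `φ : G → Z` is equivariant. -/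
theorem isEquivariant_extendBeta [T2Space G] [LocallyCompactSpace G] [T2Space Z]
    [LocallyCompactSpace Z] (h𝒢 : 𝒢.IsEtale) (hA : IsProperMap A.anchor) (φ : C(G, Z))
    (hφ : ∀ γ, A.anchor (φ γ) = 𝒢.s γ)
    (hmul : ∀ (η δ : G) (h : 𝒢.s η = 𝒢.r δ),
      φ (𝒢.mul ⟨(η, δ), h⟩) = A.act ⟨(φ η, δ), (hφ η).trans h⟩) :
    IsEquivariant (betaAction h𝒢) A (extendBeta hA φ hφ) := by
  have := 𝒢.t2Space_units
  have := 𝒢.locallyCompactSpace_units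
  refine ⟨comp_extendBeta hA φ hφ, fun χ γ hγ => eq_of_forall_C0 fun h => ?_⟩
  obtain ⟨k, hk⟩ := exists_translate_of_isProperMap A h𝒢 hA γ h
  -- Replacing `h (θ χ · γ)` by `k (θ χ)` reduces the claim to `(χ · γ)(h ∘ φ) = χ (k ∘ φ)`. This is
  -- the defining property of `χ · γ`, once equivariance of `φ` shows that `k ∘ φ` is a translate of
  -- `h ∘ φ` along `γ`.
  rw [← hk.self_of_nhds (extendBeta hA φ hφ χ), apply_extendBeta, apply_extendBeta]
  refine betaAct_spec h𝒢 ⟨(χ, γ), hγ⟩ ?_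
  filter_upwards [hk] with δ hδ η hη
  change k (φ η) = h (φ _)
  rw [hmul]
  exact hδ _ _

end Equivariance

end TopologicalGroupoid

theorem mainTheorem3 {G X : Type*} [TopologicalSpace G] [TopologicalSpace X]
    [T2Space G] [LocallyCompactSpace G] [SigmaCompactSpace X]
    (𝒢 : TopologicalGroupoid G X) (h𝒢 : 𝒢.IsEtale)
    {Z : Type*} [TopologicalSpace Z] [T2Space Z] [LocallyCompactSpace Z]
    (A : 𝒢.RightAction Z) (hproper : IsProperMap A.anchor)
    (hsurj : Function.Surjective A.anchor)
    (hsection : ∃ σ : X → Z, Continuous σ ∧ ∀ x, A.anchor (σ x) = x) :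
    ∃ θ : 𝒢.Beta → Z, Continuous θ ∧ IsProperMap θ ∧
      TopologicalGroupoid.IsEquivariant (TopologicalGroupoid.betaAction h𝒢) A θ := by
  obtain ⟨σ, hσc, hσ⟩ := hsection
  let φ := TopologicalGroupoid.orbitMap A ⟨σ, hσc⟩ hσ
  have hφ := TopologicalGroupoid.anchor_orbitMap A ⟨σ, hσc⟩ hσ
  exact ⟨TopologicalGroupoid.extendBeta hproper φ hφ,
    TopologicalGroupoid.continuous_extendBeta hproper φ hφ,
    TopologicalGroupoid.isProperMap_extendBeta hproper φ hφ,
    TopologicalGroupoid.isEquivariant_extendBeta A h𝒢 hproper φ hφ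
      (TopologicalGroupoid.orbitMap_mul A ⟨σ, hσc⟩ hσ)⟩
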